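/- Let $X$ be a complex Banach space and let $T\in L(X)$ be a bounded linear operator on $X$. For $S$ a bounded operator on a complex Banach space, let $\sigma(S)$ be its spectrum, let $\sigma_b(S)$ (Browder spectrum) be the set of $\lambda\in\mathbb{C}$ such that $S-\lambda I$ is not a Fredholm operator of finite ascent and finite descent, and let $\sigma_d(S)$ (Drazin spectrum) be the set of $\lambda\in\mathbb{C}$ such that $S-\lambda I$ is not Drazin invertible, i.e. does not have both finite ascent and finite descent. For $A\subset\mathbb{C}$ and an ordinal $\alpha$, the Cantor–Bendixson derivatives are defined by $\mathrm{acc}^0A=A$, $\mathrm{acc}^{\alpha+1}A=\mathrm{acc}(\mathrm{acc}^{\alpha}A)$, where $\mathrm{acc}\,B$ is the set of accumulation points of $B$ in $\mathbb{C}$, and $\mathrm{acc}^{\alpha}A=\bigcap_{\beta<\alpha}\mathrm{acc}^{\beta}A$ for $\alpha$ a limit ordinal. Write $(M,N)\in\mathrm{Red}(T)$ if $M,N$ are closed $T$-invariant subspaces with $X=M\oplus N$, and let $T_M,T_N$ be the restrictions of $T$ to $M$ and $N$. Let $\sigma_*\in\{\sigma,\sigma_b,\sigma_d\}$. The operator $T$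 is called - $g^0_{\sigma_*}$-invertible if $0\notin\sigma_*(T)$; - $g^{\alpha+1}_{\sigma_*}$-invertible if there is $(M,N)\in\mathrm{Red}(T)$ such that $T_M$ is invertible and $\mathrm{acc}^{\alpha}\sigma_*(T_N)\subset\{0\}$; - $g^{\alpha}_{\sigma_*}$-invertible, for $\alpha$ a limit ordinal, if it is $g^{\beta}_{\sigma_*}$-invertible for some successor ordinal $\beta<\alpha$. Let $\omega$ be the first infinite ordinal and $\omega_1$ the first uncountable ordinal. Then: (i) For every $\sigma_*\in\{\sigma,\sigma_b,\sigma_d\}$ and every ordinal $\alpha\ge\omega_1$, $T$ is $g^{\alpha}_{\sigma_*}$-invertible if and only if $T$ is $g^{\beta}_{\sigma_*}$-invertible for some ordinal $\beta<\omega_1$. (ii) For all $\sigma_*,\sigma_{**}\in\{\sigma,\sigma_b,\sigma_d\}$ and every ordinal $\alpha\ge\omega$, $T$ is $g^{\alpha}_{\sigma_*}$-invertible if and only if $T$ is $g^{\alpha}_{\sigma_{**}}$-invertible. -/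

import Mathlib

open scoped Ordinal

universe u v

namespace CantorBendixsonInvertibility

/-- The `α`-th Cantor-Bendixson derivative `acc^α A` of a set `A` of complex numbers:
`acc^0 A = A`, `acc^(α+1) A` is the set of accumulation points of `acc^α A`, and at a limit
ordinal one takes the intersection of all earlier derivatives. -/
noncomputable def accIter (A : Set ℂ) (α : Ordinal.{v}) : Set ℂ :=
  Ordinal.limitRecOn α A (fun _ B => derivedSet B) (fun _ _ F => ⋂ β, ⋂ h, F β h)

section Operators

variable {X : Type u} [NormedAddCommGroup X] [NormedSpace ℂ X]

/-- `T` has finite ascent: the kernels of the powers of `T` stabilize. -/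
def HasFiniteAscent (T : X →L[ℂ] X) : Prop :=
  ∃ p : ℕ, (T ^ p).ker = (T ^ (p + 1)).ker

/-- `T` has finite descent: the ranges of the powers of `T` stabilize. -/
def HasFiniteDescent (T : X →L[ℂ] X) : Prop :=
  ∃ q : ℕ, (T ^ q).range = (T ^ (q + 1)).range

/-- Drazin invertible operators: finite ascent and finite descent. -/
def IsDrazinInvertible (T : X →L[ℂ] X) : Prop :=
  HasFiniteAscent T ∧ HasFiniteDescent T

/-- Browder operators: Fredholm operators of finite ascent and finite descent. -/
def IsBrowder (T : X →L[ℂ] X) : Prop :=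
  T.IsFredholm ∧ HasFiniteAscent T ∧ HasFiniteDescent T

/-- The Browder spectrum `σ_b(T)`. -/
def browderSpectrum (T : X →L[ℂ] X) : Set ℂ :=
  {z | ¬ IsBrowder (T - z • (1 : X →L[ℂ] X))}

/-- The Drazin spectrum `σ_d(T)`. -/
def drazinSpectrum (T : X →L[ℂ] X) : Set ℂ :=
  {z | ¬ IsDrazinInvertible (T - z • (1 : X →L[ℂ] X))}

end Operators

/-- The three choices for `σ_*`: the spectrum `σ`, the Browder spectrum `σ_b` and the Drazin
spectrum `σ_d`. -/
inductive SpectrumKind : Type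
  | ordinary
  | browder
  | drazin

section GInvertible

variable {X : Type u} [NormedAddCommGroup X] [NormedSpace ℂ X]

/-- `σ_*(T)` for the given choice of `σ_*`. -/
def SpectrumKind.spec (s : SpectrumKind) (T : X →L[ℂ] X) : Set ℂ :=
  match s with
  | .ordinary => spectrum ℂ T
  | .browder => browderSpectrum T
  | .drazin => drazinSpectrum T

/-- `(M, N) ∈ Red(T)`: `M` and `N` are closed `T`-invariant subspaces and `X = M ⊕ N`. -/
structure IsRed (T : X →L[ℂ] X) (M N : Submodule ℂ X) : Prop where
  isClosed_left : IsClosed (M : Set X)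
  isClosed_right : IsClosed (N : Set X)
  invariant_left : ∀ x ∈ M, T x ∈ M
  invariant_right : ∀ x ∈ N, T x ∈ N
  isCompl : IsCompl M N

/-- `g^α_{σ_*}`-invertibility of `T`. The second clause is the one for the successor ordinal
`β + 1`; the third one, for a limit ordinal `α`, asks for `g^(β+1)_{σ_*}`-invertibility for some
successor ordinal `β + 1 < α`. -/
noncomputable def IsGInvertible (s : SpectrumKind) (α : Ordinal.{v}) (T : X →L[ℂ] X) : Prop :=
  Ordinal.limitRecOn α
    (0 ∉ s.spec T)
    (fun β _ => ∃ (M N : Submodule ℂ X) (h : IsRed T M N),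
      IsUnit (T.restrict h.invariant_left) ∧
        accIter (s.spec (T.restrict h.invariant_right)) β ⊆ {0})
    (fun α _ G => ∃ (β : Ordinal.{v}) (h : β + 1 < α), G (β + 1) h)

end GInvertible

end CantorBendixsonInvertibility

/-! If `T - z` is Drazin invertible, then `X` splits into a part on which `T - z` is invertible and
one on which it is nilpotent, so `z` is not an accumulation point of `σ(T)`. Hence
`acc σ(T) ⊆ σ_d(T) ⊆ σ_b(T) ⊆ σ(T)`, and one derivative pays for exchanging any of these spectra for
any other: `acc^(1+α) σ_*(T) ⊆ acc^α σ_**(T)`, where `1 + α = α` as soon as `α ≥ ω`. The bound `ω₁`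
holds because `ℂ` is hereditarily Lindelöf: the intersection of all countable derivatives of a
closed set is already that of countably many of them. -/

namespace CantorBendixsonInvertibility

section Derivatives

variable {A B : Set ℂ}

lemma accIter_zero (A : Set ℂ) : accIter A (0 : Ordinal.{v}) = A :=
  Ordinal.limitRecOn_zero ..

lemma accIter_add_one (A : Set ℂ) (α : Ordinal.{v}) :
    accIter A (α + 1) = derivedSet (accIter A α) :=
  Ordinal.limitRecOn_add_one ..

lemma accIter_limit (A : Set ℂ) {α : Ordinal.{v}} (hα : Order.IsSuccLimit α) :
    accIter A α = ⋂ β < α, accIter A β :=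
  Ordinal.limitRecOn_limit _ _ _ _ hα

lemma isClosed_accIter (hA : IsClosed A) (α : Ordinal.{v}) : IsClosed (accIter A α) := by
  induction α using Ordinal.limitRecOn with
  | zero => rwa [accIter_zero]
  | add_one α => rw [accIter_add_one]; exact isClosed_derivedSet _
  | limit α hα ih => rw [accIter_limit A hα]; exact isClosed_biInter ih

lemma accIter_antitone (hA : IsClosed A) : Antitone (accIter A : Ordinal.{v} → Set ℂ) := by
  intro β α hβα
  induction α using Ordinal.limitRecOn with
  | zero => rw [nonpos_iff_eq_zero.1 hβα]
  | add_one α ih =>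
    rcases hβα.eq_or_lt with rfl | hlt
    · exact le_rfl
    · have hstep : derivedSet (accIter A α) ⊆ accIter A α :=
        (isClosed_iff_derivedSet_subset _).1 (isClosed_accIter hA α)
      rw [accIter_add_one]
      exact hstep.trans (ih (Order.lt_add_one_iff.1 hlt))
  | limit α hα =>
    rcases hβα.eq_or_lt with rfl | hlt
    · exact le_rfl
    · rw [accIter_limit A hα]
      exact Set.biInter_subset_of_mem hlt

lemma accIter_one_add_subset (h : derivedSet A ⊆ B) (α : Ordinal.{v}) :
    accIter A (1 + α) ⊆ accIter B α := by
  induction α using Ordinal.limitRecOn with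
  | zero => rwa [add_zero, ← zero_add 1, accIter_add_one, accIter_zero, accIter_zero]
  | add_one α ih =>
    rw [← add_assoc, accIter_add_one, accIter_add_one]
    exact derivedSet_mono _ _ ih
  | limit α hα ih =>
    rw [accIter_limit B hα, accIter_limit A (Ordinal.isSuccLimit_add 1 hα)]
    exact Set.subset_iInter₂ fun β hβ =>
      (Set.biInter_subset_of_mem (show 1 + β < 1 + α by gcongr)).trans (ih β hβ)

lemma accIter_subset_of_subset_add_one (hA : IsClosed A) {γ : Ordinal.{v}}
    (hγ : accIter A γ ⊆ accIter A (γ + 1)) (α : Ordinal.{v}) : accIter A γ ⊆ accIter A α := by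
  induction α using Ordinal.limitRecOn with
  | zero => exact accIter_antitone hA zero_le
  | add_one α ih =>
    rw [accIter_add_one] at hγ ⊢
    exact hγ.trans (derivedSet_mono _ _ ih)
  | limit α hα ih =>
    rw [accIter_limit A hα]
    exact Set.subset_iInter₂ ih

lemma exists_lt_omega_one_forall_subset {Y : Type*} [TopologicalSpace Y]
    [HereditarilyLindelofSpace Y] {F : Ordinal.{v} → Set Y} (hF : Antitone F)
    (hclosed : ∀ α, IsClosed (F α)) : ∃ γ < (ω₁ : Ordinal.{v}), ∀ α < ω₁, F γ ⊆ F α := by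
  have : Nonempty (Set.Iio (ω₁ : Ordinal.{v})) := ⟨0, Ordinal.omega_pos 1⟩
  obtain ⟨k, hk⟩ := eq_closed_inter_nat (fun β : Set.Iio (ω₁ : Ordinal.{v}) => F β)
    fun β => hclosed β
  refine ⟨⨆ n, (k n : Ordinal.{v}), Ordinal.iSup_lt_omega_one fun n => (k n).2, fun α hα => ?_⟩
  calc F (⨆ n, (k n : Ordinal.{v}))
      ⊆ ⋂ n, F (k n) := Set.subset_iInter fun n =>
        hF (Ordinal.le_iSup (fun n => (k n : Ordinal.{v})) n)
    _ = ⋂ β : Set.Iio (ω₁ : Ordinal.{v}), F β := hk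
    _ ⊆ F α := Set.iInter_subset (fun β : Set.Iio (ω₁ : Ordinal.{v}) => F β) ⟨α, hα⟩

lemma exists_lt_omega_one_forall_accIter_subset (hA : IsClosed A) :
    ∃ γ < (ω₁ : Ordinal.{v}), ∀ α : Ordinal.{v}, accIter A γ ⊆ accIter A α := by
  obtain ⟨γ, hγ, hmin⟩ :=
    exists_lt_omega_one_forall_subset (accIter_antitone hA) (isClosed_accIter hA)
  have hsucc : γ + 1 < ω₁ := (Cardinal.isSuccLimit_omega 1).add_one_lt hγ
  exact ⟨γ, hγ, accIter_subset_of_subset_add_one hA (hmin _ hsucc)⟩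

end Derivatives

section Endomorphisms

variable {R V : Type*} [Ring R] [AddCommGroup V] [Module R V]

lemma range_pow_add_eq {f : Module.End R V} {q : ℕ}
    (h : LinearMap.range (f ^ q) = LinearMap.range (f ^ (q + 1))) (k : ℕ) :
    LinearMap.range (f ^ (q + k)) = LinearMap.range (f ^ q) := by
  induction k with
  | zero => rfl
  | succ k ih =>
    rw [← add_assoc, pow_succ', Module.End.mul_eq_comp, LinearMap.range_comp, ih,
      ← LinearMap.range_comp, ← Module.End.mul_eq_comp, ← pow_succ', h]

lemma isCompl_range_ker_of_mul_self {f : Module.End R V}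
    (hrange : LinearMap.range (f * f) = LinearMap.range f)
    (hker : LinearMap.ker (f * f) = LinearMap.ker f) :
    IsCompl (LinearMap.range f) (LinearMap.ker f) := by
  refine IsCompl.of_le ?_ fun x _ => ?_
  · rintro _ ⟨⟨y, rfl⟩, hy⟩
    exact hker.le hy
  · obtain ⟨y, hy⟩ : f x ∈ LinearMap.range (f * f) := hrange.ge ⟨x, rfl⟩
    have hxy : x - f y ∈ LinearMap.ker f := by
      rw [LinearMap.mem_ker, map_sub, sub_eq_zero]
      exact hy.symm
    exact Submodule.mem_sup.2 ⟨f y, ⟨y, rfl⟩, x - f y, hxy, add_sub_cancel _ _⟩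

lemma bijective_restrict_range {f : Module.End R V}
    (h : IsCompl (LinearMap.range f) (LinearMap.ker f))
    (hinv : ∀ x ∈ LinearMap.range f, f x ∈ LinearMap.range f) :
    Function.Bijective (f.restrict hinv) := by
  constructor
  · rw [injective_iff_map_eq_zero]
    rintro ⟨x, hx⟩ hfx
    exact Subtype.ext (Submodule.disjoint_def.1 h.disjoint x hx (congrArg Subtype.val hfx))
  · rintro ⟨_, x, rfl⟩
    obtain ⟨r, hr, k, hk, rfl⟩ :=
      Submodule.mem_sup.1 (h.sup_eq_top ▸ Submodule.mem_top (x := x))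
    refine ⟨⟨r, hr⟩, Subtype.ext ?_⟩
    change f r = f (r + k)
    rw [map_add, LinearMap.mem_ker.1 hk, add_zero]

lemma isUnit_restrict_range_pow {f : Module.End R V} {n : ℕ} (hn : n ≠ 0)
    (h : IsCompl (LinearMap.range (f ^ n)) (LinearMap.ker (f ^ n)))
    (hinv : ∀ x ∈ LinearMap.range (f ^ n), f x ∈ LinearMap.range (f ^ n)) :
    IsUnit (f.restrict hinv) := by
  rw [← isUnit_pow_iff hn, Module.End.pow_restrict, Module.End.isUnit_iff]
  exact bijective_restrict_range h _

lemma isNilpotent_restrict_ker_pow {f : Module.End R V} {n : ℕ}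
    (hinv : ∀ x ∈ LinearMap.ker (f ^ n), f x ∈ LinearMap.ker (f ^ n)) :
    IsNilpotent (f.restrict hinv) := by
  refine ⟨n, ?_⟩
  rw [Module.End.pow_restrict]
  ext x
  exact x.2

lemma bijective_iff_restrict {f : Module.End R V} {M N : Submodule R V} (h : IsCompl M N)
    (hM : ∀ x ∈ M, f x ∈ M) (hN : ∀ x ∈ N, f x ∈ N) :
    Function.Bijective f ↔
      Function.Bijective (f.restrict hM) ∧ Function.Bijective (f.restrict hN) := by
  let e := M.prodEquivOfIsCompl N h
  have hconj : f ∘ e = e ∘ Prod.map (f.restrict hM) (f.restrict hN) := by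
    ext x
    simp [e]
  rw [← e.bijective.of_comp_iff f, hconj, Function.Bijective.of_comp_iff' e.bijective,
    Prod.map_bijective]

end Endomorphisms

section AlgebraicSpectrum

variable {𝕜 : Type*}

lemma spectrum_eq_union_restrict [CommRing 𝕜] {V : Type*} [AddCommGroup V] [Module 𝕜 V]
    {f : Module.End 𝕜 V} {M N : Submodule 𝕜 V} (h : IsCompl M N)
    (hM : ∀ x ∈ M, f x ∈ M) (hN : ∀ x ∈ N, f x ∈ N) :
    spectrum 𝕜 f = spectrum 𝕜 (f.restrict hM) ∪ spectrum 𝕜 (f.restrict hN) := by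
  ext z
  rw [← not_iff_not, Set.mem_union, not_or]
  simp only [spectrum.notMem_iff, Module.End.isUnit_iff]
  exact bijective_iff_restrict h
    (fun x hx => M.sub_mem (M.smul_mem z hx) (hM x hx))
    (fun x hx => N.sub_mem (N.smul_mem z hx) (hN x hx))

lemma notMem_spectrum_iff_isUnit_sub_smul [CommRing 𝕜] {A : Type*} [Ring A] [Algebra 𝕜 A]
    (a : A) (z : 𝕜) : z ∉ spectrum 𝕜 a ↔ IsUnit (a - z • (1 : A)) := by
  rw [spectrum.notMem_iff, ← IsUnit.neg_iff, neg_sub, Algebra.algebraMap_eq_smul_one]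

lemma spectrum_subset_singleton_zero_of_isNilpotent [Field 𝕜] {A : Type*} [Ring A] [Algebra 𝕜 A]
    {a : A} (ha : IsNilpotent a) : spectrum 𝕜 a ⊆ {0} := by
  intro z hz
  by_contra hz0
  have hunit : IsUnit (algebraMap 𝕜 A z) := (isUnit_iff_ne_zero.2 hz0).map (algebraMap 𝕜 A)
  refine hz (spectrum.mem_resolventSet_iff.2 ?_)
  rw [sub_eq_add_neg]
  exact ha.neg.isUnit_add_left_of_commute hunit (Algebra.commutes z (-a)).symm

end AlgebraicSpectrum

lemma isClosed_range_of_isCompl {𝕜 E F : Type*} [NontriviallyNormedField 𝕜]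
    [NormedAddCommGroup E] [NormedSpace 𝕜 E] [CompleteSpace E]
    [NormedAddCommGroup F] [NormedSpace 𝕜 F] [CompleteSpace F]
    (S : E →L[𝕜] F) {G : Submodule 𝕜 F} (h : IsCompl S.range G) (hG : IsClosed (G : Set F)) :
    IsClosed (S.range : Set F) := by
  have : IsClosed (S.ker : Set E) := S.isClosed_ker
  let S' : E ⧸ S.ker →L[𝕜] F := S.ker.liftQL S le_rfl
  have hrange : S'.range = S.range := S.ker.range_liftQ _ _
  have hker : S'.ker = ⊥ := Submodule.ker_liftQ_eq_bot' _ _ rfl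
  rw [← hrange] at h ⊢
  exact S'.closed_complemented_range_of_isCompl_of_ker_eq_bot G h hG hker

lemma isFredholm_of_isUnit {𝕜 E : Type*} [NontriviallyNormedField 𝕜] [CompleteSpace 𝕜]
    [NormedAddCommGroup E] [NormedSpace 𝕜 E] {S : E →L[𝕜] E} (h : IsUnit S) : S.IsFredholm := by
  obtain ⟨e, rfl⟩ := h
  exact ContinuousLinearMap.IsFredholm.of_isQuasiInverse (v := (↑e⁻¹ : E →L[𝕜] E))
    (ContinuousLinearEquiv.ofUnit e).toLinearEquiv.isQuasiInverse

section Operators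

variable {X : Type u} [NormedAddCommGroup X] [NormedSpace ℂ X] {T : X →L[ℂ] X}

lemma IsDrazinInvertible.exists_isCompl (h : IsDrazinInvertible T) :
    ∃ n ≠ 0, IsCompl (LinearMap.range ((T : Module.End ℂ X) ^ n))
      (LinearMap.ker ((T : Module.End ℂ X) ^ n)) := by
  obtain ⟨⟨p, hp⟩, q, hq⟩ := h
  simp only [ContinuousLinearMap.toLinearMap_pow] at hp hq
  refine ⟨p + q + 1, Nat.succ_ne_zero _, isCompl_range_ker_of_mul_self ?_ ?_⟩ <;>
    rw [← pow_add]
  · rw [show p + q + 1 = q + (p + 1) by ring, add_assoc, range_pow_add_eq hq, range_pow_add_eq hq]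
  · rw [add_assoc p, add_assoc p,
      ← Module.End.ker_pow_constant hp, ← Module.End.ker_pow_constant hp]

lemma isRed_range_ker_of_commute [CompleteSpace X] {S : X →L[ℂ] X} (hTS : Commute T S)
    (h : IsCompl S.range S.ker) : IsRed T S.range S.ker where
  isClosed_left := isClosed_range_of_isCompl S h S.isClosed_ker
  isClosed_right := S.isClosed_ker
  invariant_left := by
    rintro _ ⟨y, rfl⟩
    exact ⟨T y, DFunLike.congr_fun hTS.eq.symm y⟩
  invariant_right x hx := by
    have hSx : S x = 0 := hx
    have hcomm : S (T x) = T (S x) := DFunLike.congr_fun hTS.eq.symm x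
    exact hcomm.trans (by rw [hSx, map_zero])
  isCompl := h

lemma IsDrazinInvertible.exists_isRed [CompleteSpace X] (h : IsDrazinInvertible T) :
    ∃ (M N : Submodule ℂ X) (hr : IsRed T M N), IsUnit (T.restrict hr.invariant_left) ∧
      IsNilpotent (T.restrict hr.invariant_right) := by
  obtain ⟨n, hn, hcompl⟩ := h.exists_isCompl
  have hr := isRed_range_ker_of_commute ((Commute.refl T).pow_right n)
    (by rwa [ContinuousLinearMap.toLinearMap_pow])
  rw [ContinuousLinearMap.toLinearMap_pow] at hr
  have := hr.isClosed_left.completeSpace_coe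
  refine ⟨_, _, hr, ?_, ?_⟩
  · rw [ContinuousLinearMap.isUnit_iff_isUnit_toLinearMap]
    exact isUnit_restrict_range_pow hn hcompl hr.invariant_left
  · rw [← IsNilpotent.map_iff (f := ContinuousLinearMap.toLinearMapRingHom)
      ContinuousLinearMap.coe_injective]
    exact isNilpotent_restrict_ker_pow hr.invariant_right

lemma IsRed.spectrum_eq_union [CompleteSpace X] {M N : Submodule ℂ X} (h : IsRed T M N) :
    spectrum ℂ T =
      spectrum ℂ (T.restrict h.invariant_left) ∪ spectrum ℂ (T.restrict h.invariant_right) := by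
  have := h.isClosed_left.completeSpace_coe
  have := h.isClosed_right.completeSpace_coe
  simp only [ContinuousLinearMap.spectrum_eq]
  exact spectrum_eq_union_restrict h.isCompl h.invariant_left h.invariant_right

lemma isBrowder_of_isUnit (h : IsUnit T) : IsBrowder T := by
  obtain ⟨hinj, hsurj⟩ : Function.Bijective (T : X →ₗ[ℂ] X) :=
    (Module.End.isUnit_iff _).1 (h.map ContinuousLinearMap.toLinearMapRingHom)
  refine ⟨isFredholm_of_isUnit h, ⟨0, ?_⟩, ⟨0, ?_⟩⟩
  · rw [zero_add, pow_zero, pow_one, LinearMap.ker_eq_bot.2 hinj]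
    exact LinearMap.ker_id
  · rw [zero_add, pow_zero, pow_one, LinearMap.range_eq_top.2 hsurj]
    exact LinearMap.range_id

lemma browderSpectrum_subset_spectrum (T : X →L[ℂ] X) : browderSpectrum T ⊆ spectrum ℂ T :=
  fun z hz => not_imp_comm.1
    (fun hz' => isBrowder_of_isUnit ((notMem_spectrum_iff_isUnit_sub_smul T z).1 hz')) hz

lemma drazinSpectrum_subset_browderSpectrum (T : X →L[ℂ] X) :
    drazinSpectrum T ⊆ browderSpectrum T :=
  fun _ hz hb => hz hb.2

lemma spec_subset_spectrum (s : SpectrumKind) (T : X →L[ℂ] X) : s.spec T ⊆ spectrum ℂ T :=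
  match s with
  | .ordinary => subset_rfl
  | .browder => browderSpectrum_subset_spectrum T
  | .drazin => (drazinSpectrum_subset_browderSpectrum T).trans (browderSpectrum_subset_spectrum T)

lemma drazinSpectrum_subset_spec (s : SpectrumKind) (T : X →L[ℂ] X) :
    drazinSpectrum T ⊆ s.spec T :=
  match s with
  | .ordinary => (drazinSpectrum_subset_browderSpectrum T).trans (browderSpectrum_subset_spectrum T)
  | .browder => drazinSpectrum_subset_browderSpectrum T
  | .drazin => subset_rfl

variable [CompleteSpace X]

lemma zero_notMem_derivedSet_spectrum_of_isUnit (h : IsUnit T) :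
    0 ∉ derivedSet (spectrum ℂ T) :=
  Set.notMem_subset ((isClosed_iff_derivedSet_subset _).1 (spectrum.isClosed T))
    (spectrum.zero_notMem ℂ h)

lemma IsDrazinInvertible.zero_notMem_derivedSet_spectrum (h : IsDrazinInvertible T) :
    0 ∉ derivedSet (spectrum ℂ T) := by
  obtain ⟨M, N, hr, hM, hN⟩ := h.exists_isRed
  have := hr.isClosed_left.completeSpace_coe
  have hzeroM : 0 ∉ derivedSet (spectrum ℂ (T.restrict hr.invariant_left)) :=
    zero_notMem_derivedSet_spectrum_of_isUnit hM
  have hzeroN : 0 ∉ derivedSet (spectrum ℂ (T.restrict hr.invariant_right)) := fun hacc =>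
    Set.Infinite.of_accPt (mem_derivedSet.1 hacc)
      ((Set.finite_singleton 0).subset (spectrum_subset_singleton_zero_of_isNilpotent hN))
  rw [hr.spectrum_eq_union, derivedSet_union, Set.mem_union, not_or]
  exact ⟨hzeroM, hzeroN⟩

lemma derivedSet_spectrum_subset_drazinSpectrum (T : X →L[ℂ] X) :
    derivedSet (spectrum ℂ T) ⊆ drazinSpectrum T := by
  intro z hz hd
  have htranslate : (· - z) '' spectrum ℂ T = spectrum ℂ (T - z • (1 : X →L[ℂ] X)) := by
    rw [← Algebra.algebraMap_eq_smul_one, ← spectrum.sub_singleton_eq, Set.sub_singleton]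
  have hacc : (0 : ℂ) ∈ derivedSet ((· - z) '' spectrum ℂ T) :=
    (continuous_sub_right z).image_derivedSet sub_left_injective ⟨z, hz, sub_self z⟩
  exact hd.zero_notMem_derivedSet_spectrum (htranslate ▸ hacc)

lemma derivedSet_spec_subset_spec (s s' : SpectrumKind) (T : X →L[ℂ] X) :
    derivedSet (s.spec T) ⊆ s'.spec T :=
  calc derivedSet (s.spec T)
      ⊆ derivedSet (spectrum ℂ T) := derivedSet_mono _ _ (spec_subset_spectrum s T)
    _ ⊆ drazinSpectrum T := derivedSet_spectrum_subset_drazinSpectrum T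
    _ ⊆ s'.spec T := drazinSpectrum_subset_spec s' T

lemma isClosed_spec (s : SpectrumKind) (T : X →L[ℂ] X) : IsClosed (s.spec T) :=
  (isClosed_iff_derivedSet_subset _).2 (derivedSet_spec_subset_spec s s T)

end Operators

section GInvertible

variable {X : Type u} [NormedAddCommGroup X] [NormedSpace ℂ X] {T : X →L[ℂ] X} {s : SpectrumKind}
  {α β : Ordinal.{v}}

lemma isGInvertible_zero : IsGInvertible s (0 : Ordinal.{v}) T ↔ 0 ∉ s.spec T := by
  rw [IsGInvertible, Ordinal.limitRecOn_zero]

lemma isGInvertible_add_one :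
    IsGInvertible s (β + 1) T ↔ ∃ (M N : Submodule ℂ X) (h : IsRed T M N),
      IsUnit (T.restrict h.invariant_left) ∧
        accIter (s.spec (T.restrict h.invariant_right)) β ⊆ {0} := by
  rw [IsGInvertible, Ordinal.limitRecOn_add_one]

lemma isGInvertible_limit (hα : Order.IsSuccLimit α) :
    IsGInvertible s α T ↔ ∃ β, β + 1 < α ∧ IsGInvertible s (β + 1) T := by
  rw [IsGInvertible, Ordinal.limitRecOn_limit _ _ _ _ hα]
  simp only [exists_prop]
  rfl

variable [CompleteSpace X]

lemma IsGInvertible.add_one_mono (hβα : β ≤ α) (h : IsGInvertible s (β + 1) T) :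
    IsGInvertible s (α + 1) T := by
  obtain ⟨M, N, hr, hM, hN⟩ := isGInvertible_add_one.1 h
  have := hr.isClosed_right.completeSpace_coe
  exact isGInvertible_add_one.2
    ⟨M, N, hr, hM, (accIter_antitone (isClosed_spec _ _) hβα).trans hN⟩

lemma IsDrazinInvertible.isGInvertible_one (h : IsDrazinInvertible T) (s : SpectrumKind) :
    IsGInvertible s (1 : Ordinal.{v}) T := by
  obtain ⟨M, N, hr, hM, hN⟩ := h.exists_isRed
  rw [← zero_add 1, isGInvertible_add_one]
  refine ⟨M, N, hr, hM, ?_⟩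
  rw [accIter_zero]
  exact (spec_subset_spectrum s _).trans (spectrum_subset_singleton_zero_of_isNilpotent hN)

lemma IsGInvertible.one_add (h : IsGInvertible s α T) (s' : SpectrumKind) :
    IsGInvertible s' (1 + α) T := by
  induction α using Ordinal.limitRecOn with
  | zero =>
    have hd : 0 ∉ drazinSpectrum T :=
      Set.notMem_subset (drazinSpectrum_subset_spec s T) (isGInvertible_zero.1 h)
    rw [drazinSpectrum, Set.mem_ofPred_eq, not_not, zero_smul, sub_zero] at hd
    rw [add_zero]
    exact hd.isGInvertible_one s'
  | add_one β =>
    obtain ⟨M, N, hr, hM, hN⟩ := isGInvertible_add_one.1 h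
    have := hr.isClosed_right.completeSpace_coe
    rw [← add_assoc]
    exact isGInvertible_add_one.2 ⟨M, N, hr, hM,
      (accIter_one_add_subset (derivedSet_spec_subset_spec s' s _) β).trans hN⟩
  | limit α hα ih =>
    obtain ⟨β, hβα, hβ⟩ := (isGInvertible_limit hα).1 h
    refine (isGInvertible_limit (Ordinal.isSuccLimit_add 1 hα)).2 ⟨1 + β, ?_, ?_⟩ <;>
      rw [add_assoc]
    · gcongr
    · exact ih _ hβα hβ

lemma IsGInvertible.add_one (h : IsGInvertible s α T) : IsGInvertible s (α + 1) T := by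
  induction α using Ordinal.limitRecOn with
  | zero => simpa only [zero_add, add_zero] using h.one_add s
  | add_one β => exact h.add_one_mono le_self_add
  | limit α hα =>
    obtain ⟨β, hβα, hβ⟩ := (isGInvertible_limit hα).1 h
    exact hβ.add_one_mono (le_self_add.trans hβα.le)

lemma IsGInvertible.mono (hβα : β ≤ α) (h : IsGInvertible s β T) : IsGInvertible s α T := by
  rcases hβα.eq_or_lt with rfl | hlt
  · exact h
  induction α using Ordinal.limitRecOn with
  | zero => exact absurd hlt not_lt_zero
  | add_one α ih =>
    rcases (Order.lt_add_one_iff.1 hlt).eq_or_lt with rfl | hlt'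
    · exact h.add_one
    · exact (ih hlt'.le hlt').add_one
  | limit α hα => exact (isGInvertible_limit hα).2 ⟨β, hα.add_one_lt hlt, h.add_one⟩

lemma IsGInvertible.exists_lt_omega_one (h : IsGInvertible s α T) :
    ∃ β < (ω₁ : Ordinal.{v}), IsGInvertible s β T := by
  obtain ⟨M, N, hr, hM, hN⟩ := isGInvertible_add_one.1 h.add_one
  have := hr.isClosed_right.completeSpace_coe
  obtain ⟨γ, hγ, hmin⟩ := exists_lt_omega_one_forall_accIter_subset
    (isClosed_spec s (T.restrict hr.invariant_right))
  exact ⟨γ + 1, (Cardinal.isSuccLimit_omega 1).add_one_lt hγ,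
    isGInvertible_add_one.2 ⟨M, N, hr, hM, (hmin α).trans hN⟩⟩

lemma IsGInvertible.of_omega0_le (hα : ω ≤ α) (h : IsGInvertible s α T) (s' : SpectrumKind) :
    IsGInvertible s' α T :=
  Ordinal.one_add_of_omega0_le hα ▸ h.one_add s'

end GInvertible

end CantorBendixsonInvertibility

theorem mainTheorem10 {X : Type u} [NormedAddCommGroup X] [NormedSpace ℂ X] [CompleteSpace X]
    (T : X →L[ℂ] X) :
    (∀ (s : CantorBendixsonInvertibility.SpectrumKind) (α : Ordinal.{v}), ω₁ ≤ α →
      (CantorBendixsonInvertibility.IsGInvertible s α T ↔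
        ∃ β : Ordinal.{v}, β < ω₁ ∧ CantorBendixsonInvertibility.IsGInvertible s β T)) ∧
    (∀ (s s' : CantorBendixsonInvertibility.SpectrumKind) (α : Ordinal.{v}), ω ≤ α →
      (CantorBendixsonInvertibility.IsGInvertible s α T ↔
        CantorBendixsonInvertibility.IsGInvertible s' α T)) := by
  refine ⟨fun s α hα => ⟨fun h => h.exists_lt_omega_one, ?_⟩,
    fun s s' α hα => ⟨fun h => h.of_omega0_le hα s', fun h => h.of_omega0_le hα s⟩⟩
  rintro ⟨β, hβ, h⟩
  exact h.mono (hβ.le.trans hα)
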